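/- For a Boolean function $F\colon X\times Y\to\{0,1\}$ on finite sets, let $\mathsf{R}(F)$ be the minimum worst-case cost (number of bits exchanged) of a public-coin randomized two-party protocol computing $F$ with error probability at most $1/3$ on every input pair, and let $\mathsf{D}^{\mathrm{Eq}}(F)$ be the minimum worst-case cost (bits exchanged plus oracle queries) of a deterministic two-party protocol computing $F$ in which, in any round, the parties may construct strings $a(x),b(y)\in\{0,1\}^m$ of a common arbitrary length $m$ and learn from an oracle, at unit cost, whether $a(x)=b(y)$. For $A,B\in\mathbb{F}_2^{n\times n}$ let $\mathrm{RankOne}_n(A,B)=1$ if $A\oplus B$ has $\mathbb{F}_2$-rank at most $1$, and $0$ otherwise. **Theorem.** 1. $\mathsf{R}(\mathrm{RankOne}_n)=O(1)$ and $\mathsf{D}^{\mathrm{Eq}}(\mathrm{RankOne}_n)=\Theta(n)$. (The input of each party has $n^2$ bits.) 2. Consequently there is a communication problem $F=(F_n)_{n\in\mathbb{N}}$, $F_n\colon\{0,1\}^n\times\{0,1\}^n\to\{0,1\}$, with $$\mathsf{R}(F_n)=O(1)\qquad\text{and}\qquad \mathsf{D}^{\mathrm{Eq}}(F_n)=\Theta(\sqrt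 n),$$ and it can be chosen such that for every $m$ the function $F_{m^2}$ is $\mathrm{RankOne}_m$ (the $m^2$ input bits being the entries of the matrix, row by row). 3. Hence $\mathsf{BPP}_0\not\subseteq\mathsf{P}^{\mathrm{Eq}}$, where $\mathsf{BPP}_0$ is the class of communication problems $(F_n)_n$ with $\mathsf{R}(F_n)=O(1)$, and $\mathsf{P}^{\mathrm{Eq}}$ is the class of those with $\mathsf{D}^{\mathrm{Eq}}(F_n)=O((\log n)^k)$ for some constant $k$. -/

import Mathlib

open Filter Asymptotics

namespace EqOracle

/-- Deterministic two-party communication protocols on `X × Y` with a one-bit output, as protocol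
trees: at an inner node Alice (who holds `x`) or Bob (who holds `y`) sends one bit, and the
protocol continues in the subtree given by that bit; a leaf carries the output. -/
inductive Protocol (X Y : Type) : Type
  | leaf (out : Bool) : Protocol X Y
  | alice (bit : X → Bool) (next : Bool → Protocol X Y) : Protocol X Y
  | bob (bit : Y → Bool) (next : Bool → Protocol X Y) : Protocol X Y

namespace Protocol

variable {X Y : Type}

/-- The output of the protocol on the input pair `(x, y)`. -/
def eval : Protocol X Y → X → Y → Bool
  | leaf out, _, _ => out
  | alice bit next, x, y => (next (bit x)).eval x y
  | bob bit next, x, y => (next (bit y)).eval x y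

/-- The cost: the number of bits exchanged in the worst case, i.e. the depth of the tree. -/
def cost : Protocol X Y → ℕ
  | leaf _ => 0
  | alice _ next => max (next false).cost (next true).cost + 1
  | bob _ next => max (next false).cost (next true).cost + 1

end Protocol

/-- Deterministic protocols with access to an Equality oracle. Besides sending bits, the parties
may in one round choose any length `m`, construct strings `a x` and `b y` in `{0,1}^m`, each from
the own input, and learn whether `a x = b y`. -/
inductive EqProtocol (X Y : Type) : Type
  | leaf (out : Bool) : EqProtocol X Y
  | alice (bit : X → Bool) (next : Bool → EqProtocol X Y) : EqProtocol X Y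
  | bob (bit : Y → Bool) (next : Bool → EqProtocol X Y) : EqProtocol X Y
  | query (m : ℕ) (a : X → Fin m → Bool) (b : Y → Fin m → Bool)
      (next : Bool → EqProtocol X Y) : EqProtocol X Y

namespace EqProtocol

variable {X Y : Type}

/-- The output of the protocol on the input pair `(x, y)`. -/
def eval : EqProtocol X Y → X → Y → Bool
  | leaf out, _, _ => out
  | alice bit next, x, y => (next (bit x)).eval x y
  | bob bit next, x, y => (next (bit y)).eval x y
  | query _ a b next, x, y => (next (decide (a x = b y))).eval x y

/-- The cost: the number of bits exchanged plus the number of oracle queries in the worst case,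
i.e. the depth of the tree. -/
def cost : EqProtocol X Y → ℕ
  | leaf _ => 0
  | alice _ next => max (next false).cost (next true).cost + 1
  | bob _ next => max (next false).cost (next true).cost + 1
  | query _ _ _ next => max (next false).cost (next true).cost + 1

end EqProtocol

variable {X Y : Type}

/-- `F` has a deterministic Equality-oracle protocol of cost at most `c`. -/
def HasEqCostLE (F : X → Y → Bool) (c : ℕ) : Prop :=
  ∃ P : EqProtocol X Y, P.cost ≤ c ∧ ∀ x y, P.eval x y = F x y

/-- `F` has a public-coin randomized protocol of cost at most `c` and error at most `1/3`: a
probability distribution over deterministic protocols of cost at most `c` such that on every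
input pair a random protocol is correct with probability at least `2/3`. -/
def HasRandCostLE (F : X → Y → Bool) (c : ℕ) : Prop :=
  ∃ μ : PMF (Protocol X Y), (∀ P ∈ μ.support, P.cost ≤ c) ∧
    ∀ x y, 2 / 3 ≤ μ.toOuterMeasure {P | P.eval x y = F x y}

/-- Every function on finite input sets has a deterministic protocol. -/
theorem exists_protocol [Finite X] (F : X → Y → Bool) :
    ∃ P : Protocol X Y, ∀ x y, P.eval x y = F x y := by
  classical
  have key : ∀ l : List X, ∃ P : Protocol X Y, ∀ x ∈ l, ∀ y, P.eval x y = F x y := by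
    intro l
    induction l with
    | nil => exact ⟨.leaf true, by simp⟩
    | cons a l ih =>
      obtain ⟨P, hP⟩ := ih
      refine ⟨.alice (fun x => decide (x = a)) (fun t => cond t (.bob (F a) .leaf) P), ?_⟩
      intro x hx y
      by_cases h : x = a
      · simp [Protocol.eval, h]
      · simpa [Protocol.eval, h] using hP x (by simpa [h] using hx) y
  have := Fintype.ofFinite X
  obtain ⟨P, hP⟩ := key Finset.univ.toList
  exact ⟨P, fun x y => hP x (by simp) y⟩

/-- A protocol that does not use the oracle. -/
def Protocol.toEq : Protocol X Y → EqProtocol X Y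
  | .leaf out => .leaf out
  | .alice bit next => .alice bit (fun t => (next t).toEq)
  | .bob bit next => .bob bit (fun t => (next t).toEq)

theorem Protocol.eval_toEq (P : Protocol X Y) (x : X) (y : Y) :
    P.toEq.eval x y = P.eval x y := by
  induction P with
  | leaf out => rfl
  | alice bit next ih => exact ih _
  | bob bit next ih => exact ih _

theorem exists_hasEqCostLE [Finite X] (F : X → Y → Bool) : ∃ c, HasEqCostLE F c := by
  obtain ⟨P, hP⟩ := exists_protocol F
  exact ⟨_, P.toEq, le_rfl, fun x y => (P.eval_toEq x y).trans (hP x y)⟩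

theorem exists_hasRandCostLE [Finite X] (F : X → Y → Bool) : ∃ c, HasRandCostLE F c := by
  obtain ⟨P, hP⟩ := exists_protocol F
  refine ⟨P.cost, PMF.pure P, by simp, fun x y => ?_⟩
  have hmem : P ∈ {P : Protocol X Y | P.eval x y = F x y} := hP x y
  rw [PMF.toOuterMeasure_pure_apply, if_pos hmem]
  exact ENNReal.div_le_of_le_mul (by norm_num)

open Classical in
/-- `D^Eq(F)`: the minimum cost of a deterministic Equality-oracle protocol computing `F`. -/
noncomputable def eqCost [Finite X] (F : X → Y → Bool) : ℕ :=
  Nat.find (exists_hasEqCostLE F)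

open Classical in
/-- `R(F)`: the minimum cost of a public-coin randomized protocol computing `F` with error
probability at most `1/3`. -/
noncomputable def randCost [Finite X] (F : X → Y → Bool) : ℕ :=
  Nat.find (exists_hasRandCostLE F)

/-- `RankOne_n`: decide whether `A ⊕ B` has rank at most `1` over the field with two elements. -/
noncomputable def rankOne (n : ℕ) (A B : Matrix (Fin n) (Fin n) (ZMod 2)) : Bool :=
  decide ((A + B).rank ≤ 1)

/-- The `m × m` matrix over the field with two elements whose entries, row by row, are the given
`m * m` bits. -/
def bitsToMatrix (m : ℕ) (x : Fin (m * m) → Bool) : Matrix (Fin m) (Fin m) (ZMod 2) :=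
  Matrix.of fun i j => if x (finProdFinEquiv (i, j)) then 1 else 0

/-- A communication problem: for each `n` a function `{0,1}^n × {0,1}^n → {0,1}`. -/
abbrev CommProblem : Type :=
  (n : ℕ) → (Fin n → Bool) → (Fin n → Bool) → Bool

/-- `BPP_0`: the problems of constant randomized cost. -/
def BPP0 : Set CommProblem :=
  {F | ∃ C : ℕ, ∀ n, randCost (F n) ≤ C}

/-- `P^Eq`: the problems with deterministic Equality-oracle cost `poly log n`. -/
def PEq : Set CommProblem :=
  {F | ∃ k : ℕ, (fun n => (eqCost (F n) : ℝ)) =O[atTop] fun n => Real.log (n : ℝ) ^ k}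

end EqOracle

namespace EqOracle

open Matrix

/-! Lower bound for `D^Eq`. An Equality matrix has `γ₂`-norm at most 1, so by induction on the tree
a protocol of cost `c` computes a matrix of `γ₂`-norm at most `3 ^ c` (`EqProtocol.hasGammaTwoLE`).
By Parseval, the Fourier coefficients of a function of `A + B` with small `γ₂`-norm have a small sum
over any set of frequencies (`HasGammaTwoLE.abs_sum_le`). The indicator of rank at most one has
unnormalized coefficient `2 - 2 ^ n` at every invertible frequency (`sum_sign_rank_le_one`), and at
least a quarter of all matrices are invertible; hence `2 ^ n - 2 ≤ 4 * 3 ^ c`.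

Upper bound for `D^Eq`. Over the field with two elements, rank at most one means that all nonzero
rows coincide. One query per row finds the zero rows of `A + B`, and one more query compares the
remaining rows.

Randomized bound. A random `2 × 2` compression is additive in the matrix, and its determinant
vanishes in rank at most one. Otherwise the determinant is a nonzero 4-linear form, hence nonzero
with probability at least 1/16. Eighteen repetitions suffice.

Padding carries all this to strings of every length, and `√n` outgrows every power of `log n`. -/

/-- The real number `1` or `0` that encodes a bit. -/
def bitReal (b : Bool) : ℝ := if b then 1 else 0

/-! ### The `γ₂`-norm of Equality-oracle protocols -/

/-- A factorization of a real matrix into row and column vectors of squared norm at most `t`, which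
witnesses that its `γ₂`-norm is at most `t`. -/
def HasGammaTwoLE {X Y : Type} (M : X → Y → ℝ) (t : ℝ) : Prop :=
  ∃ (ι : Type) (_ : Fintype ι) (u : X → ι → ℝ) (v : Y → ι → ℝ),
    (∀ x, ∑ i, u x i ^ 2 ≤ t) ∧ (∀ y, ∑ i, v y i ^ 2 ≤ t) ∧
      ∀ x y, M x y = ∑ i, u x i * v y i

namespace HasGammaTwoLE

variable {X Y : Type} {M N : X → Y → ℝ} {s t : ℝ}

theorem mono (h : HasGammaTwoLE M s) (hst : s ≤ t) : HasGammaTwoLE M t := by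
  obtain ⟨ι, _, u, v, hu, hv, hM⟩ := h
  exact ⟨ι, _, u, v, fun x => (hu x).trans hst, fun y => (hv y).trans hst, hM⟩

theorem neg (h : HasGammaTwoLE M t) : HasGammaTwoLE (fun x y => -M x y) t := by
  obtain ⟨ι, _, u, v, hu, hv, hM⟩ := h
  exact ⟨ι, _, u, fun y i => -v y i, hu, by simpa using hv, fun x y => by simp [hM]⟩

theorem add (hM : HasGammaTwoLE M s) (hN : HasGammaTwoLE N t) :
    HasGammaTwoLE (fun x y => M x y + N x y) (s + t) := by
  obtain ⟨ι, _, u, v, hu, hv, hM⟩ := hM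
  obtain ⟨κ, _, u', v', hu', hv', hN⟩ := hN
  refine ⟨ι ⊕ κ, inferInstance, fun x => Sum.elim (u x) (u' x), fun y => Sum.elim (v y) (v' y),
    fun x => ?_, fun y => ?_, fun x y => ?_⟩
  · simpa using add_le_add (hu x) (hu' x)
  · simpa using add_le_add (hv y) (hv' y)
  · simp [hM, hN]

/-- Tensoring the vectors multiplies both inner products and squared norms. -/
theorem mul (hs : 0 ≤ s) (hM : HasGammaTwoLE M s) (hN : HasGammaTwoLE N t) :
    HasGammaTwoLE (fun x y => M x y * N x y) (s * t) := by
  obtain ⟨ι, _, u, v, hu, hv, hM⟩ := hM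
  obtain ⟨κ, _, u', v', hu', hv', hN⟩ := hN
  refine ⟨ι × κ, inferInstance, fun x p => u x p.1 * u' x p.2, fun y p => v y p.1 * v' y p.2,
    fun x => ?_, fun y => ?_, fun x y => ?_⟩
  · simp only [mul_pow, Fintype.sum_prod_type, ← Finset.mul_sum, ← Finset.sum_mul]
    exact mul_le_mul (hu x) (hu' x) (Finset.sum_nonneg fun _ _ => sq_nonneg _) hs
  · simp only [mul_pow, Fintype.sum_prod_type, ← Finset.mul_sum, ← Finset.sum_mul]
    exact mul_le_mul (hv y) (hv' y) (Finset.sum_nonneg fun _ _ => sq_nonneg _) hs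
  · simp only [hM, hN, Fintype.sum_prod_type, Finset.sum_mul_sum]
    exact Finset.sum_congr rfl fun _ _ => Finset.sum_congr rfl fun _ _ => by ring

theorem of_rank_one (f : X → ℝ) (g : Y → ℝ) (hf : ∀ x, f x ^ 2 ≤ 1) (hg : ∀ y, g y ^ 2 ≤ 1) :
    HasGammaTwoLE (fun x y => f x * g y) 1 :=
  ⟨Unit, inferInstance, fun x _ => f x, fun y _ => g y, by simpa using hf, by simpa using hg,
    fun x y => by simp⟩

/-- The standard basis vectors at `a x` and `b y` have norm 1 whatever the size of `T`, so the
length of the queried strings does not matter. -/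
theorem of_equality {T : Type} [Fintype T] [DecidableEq T] (a : X → T) (b : Y → T) :
    HasGammaTwoLE (fun x y => bitReal (decide (a x = b y))) 1 :=
  ⟨T, inferInstance, fun x s => if a x = s then 1 else 0, fun y s => if b y = s then 1 else 0,
    fun x => by simp, fun y => by simp, fun x y => by simp [bitReal, eq_comm]⟩

end HasGammaTwoLE

theorem bitReal_sq_le (b : Bool) : bitReal b ^ 2 ≤ 1 := by
  cases b <;> simp [bitReal]

/-- A protocol with an Equality oracle of cost `c` computes a matrix of `γ₂`-norm at most `3 ^ c`. -/
theorem EqProtocol.hasGammaTwoLE {X Y : Type} (P : EqProtocol X Y) :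
    HasGammaTwoLE (fun x y => bitReal (P.eval x y)) (3 ^ P.cost) := by
  have one : HasGammaTwoLE (fun (_ : X) (_ : Y) => (1 : ℝ)) 1 := by
    simpa using HasGammaTwoLE.of_rank_one (X := X) (Y := Y) (fun _ => 1) (fun _ => 1)
      (by simp) (by simp)
  have key : ∀ (E : X → Y → Bool) (next : Bool → EqProtocol X Y),
      HasGammaTwoLE (fun x y => bitReal (E x y)) 1 →
      (∀ t, HasGammaTwoLE (fun x y => bitReal ((next t).eval x y)) (3 ^ (next t).cost)) →
      HasGammaTwoLE (fun x y => bitReal ((next (E x y)).eval x y))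
        (3 ^ (max (next false).cost (next true).cost + 1)) := by
    intro E next hE ih
    have hF := (ih false).mono
      (pow_le_pow_right₀ (by norm_num) (le_max_left _ (next true).cost))
    have hT := (ih true).mono
      (pow_le_pow_right₀ (by norm_num) (le_max_right (next false).cost _))
    -- With branches `T` and `F` and selector `E` the result is `E * T + F - E * F`; its three terms
    -- give the factor 3.
    have h := ((hE.mul zero_le_one hT).add hF).add (hE.neg.mul zero_le_one hF)
    convert h using 1
    · funext x y
      cases E x y
      · simp [bitReal]
      · simp only [bitReal, if_true]
        ring
    · ring
  induction P with
  | leaf out =>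
    simpa [EqProtocol.eval, EqProtocol.cost] using
      HasGammaTwoLE.of_rank_one (X := X) (Y := Y) (fun _ => bitReal out) (fun _ => 1)
        (fun _ => bitReal_sq_le _) (by simp)
  | alice bit next ih =>
    refine key (fun x _ => bit x) next ?_ ih
    simpa using HasGammaTwoLE.of_rank_one (X := X) (Y := Y) (fun x => bitReal (bit x)) (fun _ => 1)
      (fun _ => bitReal_sq_le _) (by simp)
  | bob bit next ih =>
    refine key (fun _ y => bit y) next ?_ ih
    simpa using HasGammaTwoLE.of_rank_one (X := X) (Y := Y) (fun _ => 1) (fun y => bitReal (bit y))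
      (by simp) (fun _ => bitReal_sq_le _)
  | query m a b next ih =>
    exact key (fun x y => decide (a x = b y)) next (HasGammaTwoLE.of_equality a b) ih

/-! ### Correlation with orthogonal characters -/

/-- Matrices of small `γ₂`-norm correlate badly with sums of products of orthogonal characters. -/
theorem HasGammaTwoLE.abs_sum_le {G H : Type} [Fintype G] [Fintype H] [DecidableEq G]
    {χ : H → G → ℝ} {q : ℝ} (hχ : ∀ A B, ∑ C, χ C A * χ C B = if A = B then q else 0)
    {M : G → G → ℝ} {t : ℝ} (hM : HasGammaTwoLE M t) (hq : 0 ≤ q) (S : Finset H) :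
    |∑ C ∈ S, ∑ A, ∑ B, χ C A * χ C B * M A B| ≤ q * Fintype.card G * t := by
  obtain ⟨ι, _, u, v, hu, hv, hM⟩ := hM
  have parseval : ∀ f : G → ℝ, ∑ C, (∑ A, χ C A * f A) ^ 2 = q * ∑ A, f A ^ 2 := by
    intro f
    calc ∑ C, (∑ A, χ C A * f A) ^ 2
        = ∑ C, ∑ A, ∑ B, f A * f B * (χ C A * χ C B) := by
          refine Finset.sum_congr rfl fun C _ => ?_
          rw [sq, Finset.sum_mul_sum]
          exact Finset.sum_congr rfl fun _ _ => Finset.sum_congr rfl fun _ _ => by ring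
      _ = ∑ A, ∑ B, f A * f B * ∑ C, χ C A * χ C B := by
          rw [Finset.sum_comm]
          refine Finset.sum_congr rfl fun A _ => ?_
          rw [Finset.sum_comm]
          simp only [Finset.mul_sum]
      _ = q * ∑ A, f A ^ 2 := by
          simp only [hχ, mul_ite, mul_zero, Finset.sum_ite_eq, Finset.mem_univ, if_true,
            Finset.mul_sum]
          exact Finset.sum_congr rfl fun _ _ => by ring
  have bound : ∀ w : G → ι → ℝ, (∀ x, ∑ i, w x i ^ 2 ≤ t) →
      ∑ C ∈ S, ∑ i, (∑ A, χ C A * w A i) ^ 2 ≤ q * Fintype.card G * t := by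
    intro w hw
    calc ∑ C ∈ S, ∑ i, (∑ A, χ C A * w A i) ^ 2
        ≤ ∑ C, ∑ i, (∑ A, χ C A * w A i) ^ 2 :=
          Finset.sum_le_univ_sum_of_nonneg fun C => Finset.sum_nonneg fun _ _ => sq_nonneg _
      _ = q * ∑ A, ∑ i, w A i ^ 2 := by
          rw [Finset.sum_comm, Finset.sum_comm (s := (Finset.univ : Finset G)), Finset.mul_sum]
          exact Finset.sum_congr rfl fun i _ => parseval fun A => w A i
      _ ≤ q * ∑ _A : G, t := by gcongr with A; exact hw A
      _ = q * Fintype.card G * t := by simp [mul_assoc]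
  have expand : ∀ C, ∑ A, ∑ B, χ C A * χ C B * M A B =
      ∑ i, (∑ A, χ C A * u A i) * ∑ B, χ C B * v B i := by
    intro C
    simp only [Finset.sum_mul_sum]
    simp only [hM, Finset.mul_sum]
    rw [Finset.sum_comm (s := (Finset.univ : Finset ι))]
    refine Finset.sum_congr rfl fun A _ => ?_
    rw [Finset.sum_comm]
    exact Finset.sum_congr rfl fun _ _ => Finset.sum_congr rfl fun _ _ => by ring
  -- Both families of vectors obey the same bound, so `|a * b| ≤ (a ^ 2 + b ^ 2) / 2` replaces
  -- Cauchy-Schwarz.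
  calc |∑ C ∈ S, ∑ A, ∑ B, χ C A * χ C B * M A B|
      ≤ ∑ C ∈ S, ∑ i, ((∑ A, χ C A * u A i) ^ 2 + (∑ B, χ C B * v B i) ^ 2) / 2 := by
        simp only [expand]
        refine (Finset.abs_sum_le_sum_abs _ _).trans (Finset.sum_le_sum fun C _ => ?_)
        refine (Finset.abs_sum_le_sum_abs _ _).trans (Finset.sum_le_sum fun i _ => ?_)
        rw [abs_le]
        constructor
        · nlinarith [sq_nonneg ((∑ A, χ C A * u A i) + ∑ B, χ C B * v B i)]
        · nlinarith [sq_nonneg ((∑ A, χ C A * u A i) - ∑ B, χ C B * v B i)]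
    _ = (∑ C ∈ S, ∑ i, (∑ A, χ C A * u A i) ^ 2 + ∑ C ∈ S, ∑ i, (∑ B, χ C B * v B i) ^ 2) / 2 := by
        simp only [← Finset.sum_div, Finset.sum_add_distrib]
    _ ≤ q * Fintype.card G * t := by linarith [bound u hu, bound v hv]

/-! ### Fourier analysis on matrices over the field with two elements -/

/-- The nontrivial additive character of the field with two elements. -/
def sign (a : ZMod 2) : ℝ := if a = 0 then 1 else -1

theorem sign_zero : sign 0 = 1 := by simp [sign]

theorem sign_add (a b : ZMod 2) : sign (a + b) = sign a * sign b := by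
  have h : (1 : ZMod 2) + 1 = 0 := rfl
  have hcases : ∀ a : ZMod 2, a = 0 ∨ a = 1 := by decide
  rcases hcases a with rfl | rfl <;> rcases hcases b with rfl | rfl <;> simp [sign, h]

theorem sign_mul_self (a : ZMod 2) : sign a * sign a = 1 := by
  rw [← sign_add, CharTwo.add_self_eq_zero, sign_zero]

/-- Translation by `g` permutes the terms and flips every sign. -/
theorem sum_sign_eq_zero {G : Type} [AddCommGroup G] [Fintype G] (φ : G →+ ZMod 2) {g : G}
    (hg : φ g ≠ 0) : ∑ x, sign (φ x) = 0 := by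
  have h : ∑ x, sign (φ x) = ∑ x, sign (φ (x + g)) :=
    (Equiv.sum_comp (Equiv.addRight g) fun x => sign (φ x)).symm
  have hs : sign (φ g) = -1 := by simp [sign, hg]
  simp only [map_add, sign_add, hs, ← Finset.sum_mul] at h
  linarith

variable {n : ℕ}

/-- The entrywise inner product with a fixed matrix. -/
def entryPairing (D : Matrix (Fin n) (Fin n) (ZMod 2)) :
    Matrix (Fin n) (Fin n) (ZMod 2) →+ ZMod 2 where
  toFun C := ∑ i, ∑ j, D i j * C i j
  map_zero' := by simp
  map_add' A B := by simp [mul_add, Finset.sum_add_distrib]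

theorem entryPairing_apply (D C : Matrix (Fin n) (Fin n) (ZMod 2)) :
    entryPairing D C = ∑ i, ∑ j, D i j * C i j := rfl

theorem entryPairing_comm (C D : Matrix (Fin n) (Fin n) (ZMod 2)) :
    entryPairing C D = entryPairing D C := by
  simp only [entryPairing_apply, mul_comm]

theorem entryPairing_single (D : Matrix (Fin n) (Fin n) (ZMod 2)) (i j : Fin n) :
    entryPairing D (Matrix.single i j 1) = D i j := by
  rw [entryPairing_apply, Finset.sum_eq_single i, Finset.sum_eq_single j]
  · simp
  · intro l _ hl
    simp [hl.symm]
  · simp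
  · intro k _ hk
    simp [hk.symm]
  · simp

theorem entryPairing_vecMulVec (C : Matrix (Fin n) (Fin n) (ZMod 2)) (u v : Fin n → ZMod 2) :
    entryPairing C (vecMulVec u v) = u ⬝ᵥ C *ᵥ v := by
  simp only [entryPairing_apply, vecMulVec_apply, dotProduct, mulVec, Finset.mul_sum]
  exact Finset.sum_congr rfl fun _ _ => Finset.sum_congr rfl fun _ _ => by ring

theorem matrix_add_eq_zero_iff (A B : Matrix (Fin n) (Fin n) (ZMod 2)) : A + B = 0 ↔ A = B := by
  constructor
  · intro h
    ext i j
    have := congrFun (congrFun h i) j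
    simpa [CharTwo.add_eq_zero] using this
  · rintro rfl
    ext i j
    simp [CharTwo.add_self_eq_zero]

theorem sum_sign_entryPairing (A B : Matrix (Fin n) (Fin n) (ZMod 2)) :
    ∑ C, sign (entryPairing C A) * sign (entryPairing C B) =
      if A = B then (Fintype.card (Matrix (Fin n) (Fin n) (ZMod 2)) : ℝ) else 0 := by
  have h : ∀ C, sign (entryPairing C A) * sign (entryPairing C B) =
      sign (entryPairing (A + B) C) := fun C => by
    rw [← sign_add, ← map_add, entryPairing_comm]
  simp only [h]
  split_ifs with hAB
  · rw [(matrix_add_eq_zero_iff A B).2 hAB]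
    simp [entryPairing_apply, sign_zero]
  · have h0 : A + B ≠ 0 := fun h0 => hAB ((matrix_add_eq_zero_iff A B).1 h0)
    obtain ⟨i, j, hij⟩ : ∃ i j, (A + B) i j ≠ 0 := by
      by_contra! hc
      exact h0 (Matrix.ext hc)
    exact sum_sign_eq_zero (entryPairing (A + B)) (g := Matrix.single i j 1)
      (by rwa [entryPairing_single])

theorem sum_sign_dotProduct (w : Fin n → ZMod 2) :
    ∑ u : Fin n → ZMod 2, sign (u ⬝ᵥ w) = if w = 0 then (2 : ℝ) ^ n else 0 := by
  split_ifs with h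
  · simp [h, sign_zero]
  · obtain ⟨i, hi⟩ := Function.ne_iff.1 h
    let φ : (Fin n → ZMod 2) →+ ZMod 2 :=
      { toFun := fun u => u ⬝ᵥ w
        map_zero' := by simp
        map_add' := fun a b => add_dotProduct a b w }
    exact sum_sign_eq_zero φ (g := Pi.single i 1) (by simpa [φ] using hi)

theorem rank_le_one_iff_exists_vecMulVec {K : Type} [Field K] (M : Matrix (Fin n) (Fin n) K) :
    M.rank ≤ 1 ↔ ∃ u v, M = vecMulVec u v := by
  constructor
  · intro h
    obtain ⟨⟨w, hw⟩, hspan⟩ := finrank_le_one_iff.1 h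
    have hcol : ∀ j, ∃ c : K, c • w = M.col j := fun j => by
      obtain ⟨c, hc⟩ := hspan ⟨M *ᵥ Pi.single j 1, ⟨Pi.single j 1, rfl⟩⟩
      exact ⟨c, by simpa using congrArg Subtype.val hc⟩
    choose c hc using hcol
    refine ⟨w, c, Matrix.ext fun i j => ?_⟩
    have := congrFun (hc j) i
    simp only [Pi.smul_apply, smul_eq_mul, Matrix.col_apply] at this
    rw [vecMulVec_apply, ← this, mul_comm]
  · rintro ⟨u, v, rfl⟩
    exact rank_vecMulVec_le u v

/-- The factors of a rank-one matrix are unique up to a nonzero scalar, and here the only such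
scalar is 1. -/
theorem vecMulVec_injOn :
    Set.InjOn (fun p : (Fin n → ZMod 2) × (Fin n → ZMod 2) => vecMulVec p.1 p.2)
      {p | p.1 ≠ 0 ∧ p.2 ≠ 0} := by
  have unit : ∀ a : ZMod 2, a ≠ 0 → a = 1 := by decide
  rintro ⟨u, v⟩ ⟨hu, hv⟩ ⟨u', v'⟩ ⟨hu', hv'⟩ h
  have e : ∀ i j, u i * v j = u' i * v' j := fun i j => congrFun (congrFun h i) j
  simp only at hu hv hu' hv'
  obtain ⟨i, hi⟩ := Function.ne_iff.1 hu
  obtain ⟨j, hj⟩ := Function.ne_iff.1 hv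
  have hi := unit _ hi
  have hj := unit _ hj
  have hij := e i j
  rw [hi, hj, one_mul] at hij
  have hi' : u' i = 1 := unit _ fun h0 => by simp [h0] at hij
  have hj' : v' j = 1 := unit _ fun h0 => by simp [h0] at hij
  refine Prod.ext (funext fun k => ?_) (funext fun k => ?_)
  · simpa [hj, hj'] using e k j
  · simpa [hi, hi'] using e i k

/-- The Fourier coefficient of the indicator of the matrices of rank at most one at an invertible
matrix. -/
theorem sum_sign_rank_le_one {C : Matrix (Fin n) (Fin n) (ZMod 2)} (hC : IsUnit C) :
    ∑ A, sign (entryPairing C A) * bitReal (decide (A.rank ≤ 1)) = 2 - 2 ^ n := by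
  classical
  set f : (Fin n → ZMod 2) × (Fin n → ZMod 2) → ℝ := fun p => sign (p.1 ⬝ᵥ C *ᵥ p.2) with hf
  set S : Finset ((Fin n → ZMod 2) × (Fin n → ZMod 2)) :=
    (Finset.univ.erase 0) ×ˢ (Finset.univ.erase 0) with hS
  have hrank : Finset.univ.filter (fun A : Matrix (Fin n) (Fin n) (ZMod 2) => A.rank ≤ 1) =
      insert 0 (S.image fun p => vecMulVec p.1 p.2) := by
    ext A
    simp only [Finset.mem_filter, Finset.mem_univ, true_and, rank_le_one_iff_exists_vecMulVec,
      Finset.mem_insert, Finset.mem_image, hS, Finset.mem_product, Finset.mem_erase, and_true,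
      Prod.exists]
    constructor
    · rintro ⟨u, v, rfl⟩
      by_cases hu : u = 0
      · left; simp [hu]
      by_cases hv : v = 0
      · left; simp [hv]
      exact Or.inr ⟨u, v, ⟨hu, hv⟩, rfl⟩
    · rintro (rfl | ⟨u, v, -, rfl⟩)
      · exact ⟨0, 0, by simp⟩
      · exact ⟨u, v, rfl⟩
  have hzero : (0 : Matrix (Fin n) (Fin n) (ZMod 2)) ∉ S.image fun p => vecMulVec p.1 p.2 := by
    simp only [Finset.mem_image, hS, Finset.mem_product, Finset.mem_erase, Finset.mem_univ,
      and_true, Prod.exists, not_exists, not_and]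
    rintro u v ⟨hu, hv⟩ h
    rcases vecMulVec_eq_zero.1 h with h | h
    · exact hu h
    · exact hv h
  have hinj : Set.InjOn (fun p : (Fin n → ZMod 2) × (Fin n → ZMod 2) => vecMulVec p.1 p.2) S :=
    vecMulVec_injOn.mono fun p hp => by simpa [hS] using hp
  have hker : ∀ v, C *ᵥ v = 0 ↔ v = 0 := fun v =>
    ⟨fun h => Matrix.mulVec_injective_of_isUnit hC (by simpa using h), fun h => by simp [h]⟩
  -- The sum over `u` vanishes unless `C *ᵥ v = 0`, that is, unless `v = 0`.
  have hall : ∑ u, ∑ v, f (u, v) = 2 ^ n := by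
    rw [Finset.sum_comm]
    simp only [hf, sum_sign_dotProduct, hker, Finset.sum_ite_eq', Finset.mem_univ, if_true]
  -- Inclusion-exclusion: `f` is 1 on the lines `u = 0` and `v = 0`, so `2 ^ n - 2 ^ n - 2 ^ n + 1`
  -- remains.
  have hsum : ∑ p ∈ S, f p = 1 - 2 ^ n := by
    have e1 : ∀ u, ∑ v ∈ Finset.univ.erase 0, f (u, v) = ∑ v, f (u, v) - 1 := fun u => by
      rw [Finset.sum_erase_eq_sub (Finset.mem_univ _)]
      simp [hf, sign_zero]
    rw [hS, Finset.sum_product, Finset.sum_erase_eq_sub (Finset.mem_univ _)]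
    simp only [e1, Finset.sum_sub_distrib, hall]
    simp [hf, sign_zero]
  calc ∑ A, sign (entryPairing C A) * bitReal (decide (A.rank ≤ 1))
      = ∑ A ∈ Finset.univ.filter (fun A : Matrix (Fin n) (Fin n) (ZMod 2) => A.rank ≤ 1),
          sign (entryPairing C A) := by
        rw [Finset.sum_filter]
        exact Finset.sum_congr rfl fun A _ => by simp [bitReal]
    _ = 1 + ∑ p ∈ S, f p := by
        rw [hrank, Finset.sum_insert hzero, Finset.sum_image hinj, map_zero, sign_zero]
        simp only [entryPairing_vecMulVec, hf]
    _ = 2 - 2 ^ n := by rw [hsum]; ring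

/-! ### The lower bound for the Equality oracle -/

theorem quarter_card_le_card_GL :
    (Fintype.card (Matrix (Fin n) (Fin n) (ZMod 2)) : ℝ) ≤
      4 * Nat.card (GL (Fin n) (ZMod 2)) := by
  -- The extra summand makes the induction close: `(1/4 + x) * (1 - x) ≥ 1/4 + x/2` for `0 ≤ x ≤
  -- 1/4`.
  have hprod : ∀ m : ℕ, (1 / 4 + (1 / 2) ^ (m + 2) : ℝ) ≤
      ∏ i ∈ Finset.range (m + 1), (1 - (1 / 2) ^ (i + 1) : ℝ) := by
    intro m
    induction m with
    | zero => norm_num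
    | succ m ih =>
      rw [Finset.prod_range_succ]
      set x : ℝ := (1 / 2) ^ (m + 2) with hx
      have hx0 : 0 < x := by positivity
      have hx1 : x ≤ 1 / 4 := by
        rw [hx, pow_add]
        have : ((1 : ℝ) / 2) ^ m ≤ 1 := pow_le_one₀ (by norm_num) (by norm_num)
        linarith
      have : ((1 : ℝ) / 2) ^ (m + 1 + 2) = x / 2 := by rw [hx]; ring
      rw [this]
      nlinarith [mul_le_mul_of_nonneg_right ih (by linarith : (0 : ℝ) ≤ 1 - x)]
  have hcard : (Nat.card (GL (Fin n) (ZMod 2)) : ℝ) =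
      Fintype.card (Matrix (Fin n) (Fin n) (ZMod 2)) *
        ∏ i ∈ Finset.range n, (1 - (1 / 2) ^ (i + 1) : ℝ) := by
    have hM : (Fintype.card (Matrix (Fin n) (Fin n) (ZMod 2)) : ℝ) =
        ∏ _i ∈ Finset.range n, (2 : ℝ) ^ n := by
      have : Fintype.card (Matrix (Fin n) (Fin n) (ZMod 2)) = (2 ^ n) ^ n := by
        rw [← Nat.card_eq_fintype_card]
        change Nat.card (Fin n → Fin n → ZMod 2) = _
        simp
      simp [this]
    rw [Matrix.card_GL_field, hM, ← Finset.prod_mul_distrib, ZMod.card,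
      Fin.prod_univ_eq_prod_range (fun i => 2 ^ n - 2 ^ i) n, Nat.cast_prod,
      ← Finset.prod_range_reflect]
    refine Finset.prod_congr rfl fun i hi => ?_
    have hi := Finset.mem_range.1 hi
    rw [Nat.cast_sub (Nat.pow_le_pow_right (by norm_num) (by omega))]
    have : (2 : ℝ) ^ n = 2 ^ (n - 1 - i) * 2 ^ (i + 1) := by
      rw [← pow_add]
      congr 1
      omega
    push_cast
    rw [mul_sub, this, mul_one, mul_assoc, ← mul_pow]
    norm_num
  rw [hcard]
  have h4 : (1 / 4 : ℝ) ≤ ∏ i ∈ Finset.range n, (1 - (1 / 2) ^ (i + 1) : ℝ) := by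
    rcases n with - | m
    · norm_num
    · have : (0 : ℝ) ≤ (1 / 2) ^ (m + 2) := by positivity
      linarith [hprod m]
  have : (0 : ℝ) ≤ (Fintype.card (Matrix (Fin n) (Fin n) (ZMod 2)) : ℝ) := Nat.cast_nonneg _
  nlinarith

/-- Summing over all invertible frequencies gains a factor of a quarter of all matrices, with no
cancellation because the coefficients are equal. -/
theorem two_pow_le_of_hasEqCostLE {c : ℕ} (h : HasEqCostLE (rankOne n) c) :
    (2 : ℝ) ^ n - 2 ≤ 4 * 3 ^ c := by
  classical
  obtain ⟨P, hPc, hP⟩ := h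
  set N : ℝ := (Fintype.card (Matrix (Fin n) (Fin n) (ZMod 2)) : ℝ) with hN
  have hN0 : 0 < N := by rw [hN]; exact_mod_cast Fintype.card_pos
  have hγ := P.hasGammaTwoLE.mono (pow_le_pow_right₀ (by norm_num : (1 : ℝ) ≤ 3) hPc)
  simp only [hP] at hγ
  set S : Finset (Matrix (Fin n) (Fin n) (ZMod 2)) :=
    Finset.univ.image fun g : GL (Fin n) (ZMod 2) => (g : Matrix (Fin n) (Fin n) (ZMod 2)) with hS
  have hScard : (S.card : ℝ) = Nat.card (GL (Fin n) (ZMod 2)) := by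
    rw [hS, Finset.card_image_of_injective _ Units.val_injective, Nat.card_eq_fintype_card,
      Finset.card_univ]
  have hle := hγ.abs_sum_le sum_sign_entryPairing hN0.le S
  have hterm : ∀ C ∈ S, ∑ A, ∑ B, sign (entryPairing C A) * sign (entryPairing C B) *
      bitReal (rankOne n A B) = N * (2 - 2 ^ n) := by
    intro C hC
    obtain ⟨g, -, rfl⟩ := Finset.mem_image.1 hC
    -- Substituting `A + B` for `B` cancels the character at `A`, so each row contributes the same
    -- Fourier coefficient.
    have hrow : ∀ A, ∑ B, sign (entryPairing (g : Matrix (Fin n) (Fin n) (ZMod 2)) A) *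
        sign (entryPairing (g : Matrix (Fin n) (Fin n) (ZMod 2)) B) * bitReal (rankOne n A B) =
        2 - 2 ^ n := by
      intro A
      rw [← sum_sign_rank_le_one g.isUnit, ← Equiv.sum_comp (Equiv.addLeft A)]
      refine Finset.sum_congr rfl fun B _ => ?_
      rw [Equiv.coe_addLeft, map_add, sign_add, ← mul_assoc, sign_mul_self, one_mul, rankOne]
      simp only [← add_assoc, (matrix_add_eq_zero_iff A A).2 rfl, zero_add]
    rw [Finset.sum_congr rfl fun A _ => hrow A, Finset.sum_const, nsmul_eq_mul, Finset.card_univ]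
  rw [Finset.sum_congr rfl hterm, Finset.sum_const, nsmul_eq_mul, hScard] at hle
  have h4 := quarter_card_le_card_GL (n := n)
  rw [← hN] at h4
  have hle' := (neg_le_abs _).trans hle
  by_cases h2 : (2 : ℝ) ^ n - 2 ≤ 0
  · exact h2.trans (by positivity)
  · have h5 : N * N * ((2 : ℝ) ^ n - 2) ≤ N * N * (4 * 3 ^ c) := by
      nlinarith [mul_le_mul_of_nonneg_right h4 (mul_nonneg hN0.le (not_le.1 h2).le)]
    exact le_of_mul_le_mul_left h5 (by positivity)

/-! ### Minimal costs and local translation of inputs -/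

theorem hasEqCostLE_eqCost {X Y : Type} [Finite X] (F : X → Y → Bool) :
    HasEqCostLE F (eqCost F) := by
  classical
  exact Nat.find_spec (exists_hasEqCostLE F)

theorem eqCost_le {X Y : Type} [Finite X] {F : X → Y → Bool} {c : ℕ} (h : HasEqCostLE F c) :
    eqCost F ≤ c := by
  classical
  exact Nat.find_min' _ h

theorem randCost_le {X Y : Type} [Finite X] {F : X → Y → Bool} {c : ℕ} (h : HasRandCostLE F c) :
    randCost F ≤ c := by
  classical
  exact Nat.find_min' _ h

/-- The protocol in which the parties first translate their inputs. -/
def Protocol.comap {X Y X' Y' : Type} (f : X' → X) (g : Y' → Y) : Protocol X Y → Protocol X' Y'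
  | .leaf out => .leaf out
  | .alice bit next => .alice (fun x => bit (f x)) fun t => (next t).comap f g
  | .bob bit next => .bob (fun y => bit (g y)) fun t => (next t).comap f g

/-- The Equality-oracle protocol in which the parties first translate their inputs. -/
def EqProtocol.comap {X Y X' Y' : Type} (f : X' → X) (g : Y' → Y) :
    EqProtocol X Y → EqProtocol X' Y'
  | .leaf out => .leaf out
  | .alice bit next => .alice (fun x => bit (f x)) fun t => (next t).comap f g
  | .bob bit next => .bob (fun y => bit (g y)) fun t => (next t).comap f g
  | .query m a b next =>
    .query m (fun x => a (f x)) (fun y => b (g y)) fun t => (next t).comap f g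

section comap

variable {X Y X' Y' : Type} (f : X' → X) (g : Y' → Y)

theorem Protocol.eval_comap (P : Protocol X Y) (x : X') (y : Y') :
    (P.comap f g).eval x y = P.eval (f x) (g y) := by
  induction P with
  | leaf out => rfl
  | alice bit next ih => exact ih _
  | bob bit next ih => exact ih _

theorem Protocol.cost_comap (P : Protocol X Y) : (P.comap f g).cost = P.cost := by
  induction P with
  | leaf out => rfl
  | alice bit next ih => simp [comap, cost, ih]
  | bob bit next ih => simp [comap, cost, ih]

theorem EqProtocol.eval_comap (P : EqProtocol X Y) (x : X') (y : Y') :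
    (P.comap f g).eval x y = P.eval (f x) (g y) := by
  induction P with
  | leaf out => rfl
  | alice bit next ih => exact ih _
  | bob bit next ih => exact ih _
  | query m a b next ih => exact ih _

theorem EqProtocol.cost_comap (P : EqProtocol X Y) : (P.comap f g).cost = P.cost := by
  induction P with
  | leaf out => rfl
  | alice bit next ih => simp [comap, cost, ih]
  | bob bit next ih => simp [comap, cost, ih]
  | query m a b next ih => simp [comap, cost, ih]

theorem HasEqCostLE.comap {F : X → Y → Bool} {c : ℕ} (h : HasEqCostLE F c) :
    HasEqCostLE (fun x y => F (f x) (g y)) c := by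
  obtain ⟨P, hc, hP⟩ := h
  exact ⟨P.comap f g, (P.cost_comap f g).trans_le hc,
    fun x y => (P.eval_comap f g x y).trans (hP _ _)⟩

theorem HasRandCostLE.comap {F : X → Y → Bool} {c : ℕ} (h : HasRandCostLE F c) :
    HasRandCostLE (fun x y => F (f x) (g y)) c := by
  obtain ⟨μ, hc, hμ⟩ := h
  refine ⟨μ.map (Protocol.comap f g), ?_, fun x y => ?_⟩
  · intro P hP
    obtain ⟨Q, hQ, rfl⟩ := (PMF.mem_support_map_iff _ _ _).1 hP
    exact (Q.cost_comap f g).trans_le (hc Q hQ)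
  · rw [PMF.toOuterMeasure_map_apply]
    simpa [Set.preimage, Protocol.eval_comap] using hμ (f x) (g y)

end comap

/-! ### The upper bound for the Equality oracle -/

/-- The parties learn `k` Equality queries and go on with a protocol that depends on the answers. -/
theorem exists_eqProtocol_queries {X Y : Type} (k m : ℕ) (a : Fin k → X → Fin m → Bool)
    (b : Fin k → Y → Fin m → Bool) (next : (Fin k → Bool) → EqProtocol X Y) {c : ℕ}
    (hc : ∀ s, (next s).cost ≤ c) :
    ∃ P : EqProtocol X Y, P.cost ≤ k + c ∧
      ∀ x y, P.eval x y = (next fun i => decide (a i x = b i y)).eval x y := by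
  induction k with
  | zero =>
    exact ⟨next Fin.elim0, by simpa using hc _, fun x y => by
      congr 2
      exact Subsingleton.elim _ _⟩
  | succ k ih =>
    choose P hPc hP using fun t : Bool =>
      ih (fun i => a i.succ) (fun i => b i.succ) (fun s => next (Fin.cons t s)) fun s => hc _
    refine ⟨.query m (a 0) (b 0) P, ?_, fun x y => ?_⟩
    · have := hPc false
      have := hPc true
      simp only [EqProtocol.cost]
      omega
    · simp only [EqProtocol.eval, hP]
      congr 2
      funext i
      refine Fin.cases ?_ (fun j => ?_) i <;> simp

theorem exists_injective_bits (T : Type) [Finite T] :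
    ∃ (m : ℕ) (e : T → Fin m → Bool), Function.Injective e := by
  classical
  refine ⟨Nat.card T, fun t i => decide (Finite.equivFin T t = i), fun s t h => ?_⟩
  have := congrFun h (Finite.equivFin T t)
  simpa using this

/-- The rows of an outer product are scalar multiples of one vector, and the only nonzero scalar is
1. -/
theorem rank_le_one_iff_rows (M : Matrix (Fin n) (Fin n) (ZMod 2)) :
    M.rank ≤ 1 ↔ ∀ i j, M i ≠ 0 → M j ≠ 0 → M i = M j := by
  have unit : ∀ a : ZMod 2, a ≠ 0 → a = 1 := by decide
  rw [rank_le_one_iff_exists_vecMulVec]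
  constructor
  · rintro ⟨u, v, rfl⟩ i j hi hj
    have key : ∀ k, vecMulVec u v k ≠ 0 → u k = 1 := fun k hk => unit _ fun h0 =>
      hk (funext fun l => by simp [vecMulVec_apply, h0])
    funext l
    simp [vecMulVec_apply, key i hi, key j hj]
  · intro h
    by_cases h0 : ∃ i, M i ≠ 0
    · obtain ⟨i, hi⟩ := h0
      refine ⟨fun k => if M k = 0 then 0 else 1, M i, Matrix.ext fun k l => ?_⟩
      by_cases hk : M k = 0
      · simp [vecMulVec_apply, hk]
      · rw [vecMulVec_apply, if_neg hk, one_mul, h k i hk hi]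
    · push Not at h0
      exact ⟨0, 0, Matrix.ext fun k l => by simp [h0 k]⟩

theorem hasEqCostLE_rankOne (n : ℕ) : HasEqCostLE (rankOne n) (n + 1) := by
  classical
  obtain ⟨m, e, he⟩ := exists_injective_bits (Fin n → ZMod 2)
  obtain ⟨m', e', he'⟩ := exists_injective_bits (Fin n → Fin n → Fin n → ZMod 2)
  -- In characteristic two, `A i + B i = A j + B j` iff `A i + A j = B i + B j`, whose sides are
  -- computed locally. Pairs involving a row on which `A` and `B` agree are masked by 0.
  let diff (s : Fin n → Bool) (A : Matrix (Fin n) (Fin n) (ZMod 2)) :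
      Fin n → Fin n → Fin n → ZMod 2 := fun i j => if s i || s j then 0 else A i + A j
  obtain ⟨P, hPc, hP⟩ := exists_eqProtocol_queries n m
    (fun i (A : Matrix (Fin n) (Fin n) (ZMod 2)) => e (A i)) (fun i B => e (B i))
    (fun s => .query m' (fun A => e' (diff s A)) (fun B => e' (diff s B)) .leaf) (c := 1)
    (fun s => by simp [EqProtocol.cost])
  refine ⟨P, hPc, fun A B => ?_⟩
  rw [hP, EqProtocol.eval, EqProtocol.eval, rankOne]
  congr 1
  rw [he'.eq_iff, rank_le_one_iff_rows, eq_iff_iff]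
  have hrow : ∀ i, (A + B) i = 0 ↔ A i = B i := fun i => by
    have h : ∀ a b : ZMod 2, a + b = 0 ↔ a = b := by decide
    simp [funext_iff, h]
  have hpair : ∀ i j, (A + B) i = (A + B) j ↔ A i + A j = B i + B j := fun i j => by
    have h : ∀ a b c d : ZMod 2, a + b = c + d ↔ a + c = b + d := by decide
    simp [funext_iff, h]
  simp only [ne_eq, hrow, hpair, he.eq_iff, diff]
  constructor
  · intro h i j hi hj
    simpa [hi, hj] using congrFun (congrFun h i) j
  · intro h
    funext i j
    by_cases hi : A i = B i
    · simp [hi]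
    by_cases hj : A j = B j
    · simp [hj]
    simpa [hi, hj] using h i j hi hj

/-! ### Randomized one-message tests -/

/-- Alice sends a message of `k` bits and Bob answers with the output. -/
theorem exists_protocol_message {X Y : Type} (k : ℕ) (g : X → Fin k → Bool)
    (h : (Fin k → Bool) → Y → Bool) :
    ∃ P : Protocol X Y, P.cost ≤ k + 1 ∧ ∀ x y, P.eval x y = h (g x) y := by
  induction k with
  | zero =>
    exact ⟨.bob (h Fin.elim0) .leaf, by simp [Protocol.cost], fun x y => by
      simp only [Protocol.eval]
      congr 1
      exact Subsingleton.elim _ _⟩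
  | succ k ih =>
    choose P hPc hP using fun t : Bool => ih (fun x i => g x i.succ) fun s => h (Fin.cons t s)
    refine ⟨.alice (fun x => g x 0) P, ?_, fun x y => ?_⟩
    · have := hPc false
      have := hPc true
      simp only [Protocol.cost]
      omega
    · simp only [Protocol.eval, hP]
      congr 1
      funext i
      refine Fin.cases ?_ (fun j => ?_) i <;> simp

theorem exists_protocol_message_of_card {X Y T : Type} [Fintype T] {k : ℕ}
    (hT : Fintype.card T ≤ 2 ^ k) (g : X → T) (h : T → Y → Bool) :
    ∃ P : Protocol X Y, P.cost ≤ k + 1 ∧ ∀ x y, P.eval x y = h (g x) y := by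
  classical
  obtain ⟨e⟩ : Nonempty (T ↪ (Fin k → Bool)) :=
    Function.Embedding.nonempty_of_card_le (by simpa using hT)
  rcases isEmpty_or_nonempty T with hE | hE
  · exact ⟨.leaf true, by simp [Protocol.cost], fun x => (hE.false (g x)).elim⟩
  · obtain ⟨P, hPc, hP⟩ := exists_protocol_message k (fun x => e (g x))
      fun s => h (Function.invFun e s)
    exact ⟨P, hPc, fun x y => by rw [hP, Function.leftInverse_invFun e.injective]⟩

/-- A one-round test whose coins are uniform in a finite set, and which errs with probability at
most `1/3`. -/
theorem hasRandCostLE_of_test {X Y T Ω : Type} [Fintype T] [Fintype Ω] [Nonempty Ω] {k : ℕ}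
    (hT : Fintype.card T ≤ 2 ^ k) (g : Ω → X → T) (h : Ω → T → Y → Bool) {F : X → Y → Bool}
    (herr : ∀ x y, 3 * Nat.card {ω // h ω (g ω x) y ≠ F x y} ≤ Fintype.card Ω) :
    HasRandCostLE F (k + 1) := by
  classical
  choose P hPc hP using fun ω => exists_protocol_message_of_card hT (g ω) (h ω)
  refine ⟨(PMF.uniformOfFintype Ω).map P, ?_, fun x y => ?_⟩
  · intro Q hQ
    obtain ⟨ω, -, rfl⟩ := (PMF.mem_support_map_iff _ _ _).1 hQ
    exact hPc ω
  · rw [PMF.toOuterMeasure_map_apply, PMF.toOuterMeasure_uniformOfFintype_apply]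
    have hcompl : Nat.card {ω // h ω (g ω x) y ≠ F x y} =
        Fintype.card Ω - Fintype.card (P ⁻¹' {P | P.eval x y = F x y}) := by
      rw [Nat.card_eq_fintype_card]
      simp only [Set.preimage, Set.mem_ofPred_eq, hP, Set.coe_ofPred]
      exact Fintype.card_subtype_compl _
    have h3 := herr x y
    rw [hcompl] at h3
    have hnat : 2 * Fintype.card Ω ≤ 3 * Fintype.card (P ⁻¹' {P | P.eval x y = F x y}) := by
      omega
    have hpos : (Fintype.card Ω : ENNReal) ≠ 0 := by simp
    rw [ENNReal.le_div_iff_mul_le (Or.inl hpos) (Or.inl (ENNReal.natCast_ne_top _)),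
      div_eq_mul_inv, mul_right_comm, ← div_eq_mul_inv]
    refine ENNReal.div_le_of_le_mul ?_
    rw [mul_comm _ (3 : ENNReal)]
    exact_mod_cast hnat

/-! ### Density of the nonzeros of a multilinear form -/

/-- Translation by `g` injects the kernel into its complement. -/
theorem two_mul_card_ne_zero {G : Type} [AddCommGroup G] [Finite G] (φ : G →+ ZMod 2) {g : G}
    (hg : φ g ≠ 0) : Nat.card G ≤ 2 * Nat.card {x // φ x ≠ 0} := by
  classical
  have := Fintype.ofFinite G
  have h : Fintype.card {x // φ x = 0} ≤ Fintype.card {x // φ x ≠ 0} := by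
    refine Fintype.card_le_of_injective (fun x => ⟨x.1 + g, by simpa [x.2] using hg⟩) ?_
    rintro ⟨x, hx⟩ ⟨y, hy⟩ hxy
    simpa using hxy
  have h2 := Fintype.card_subtype_compl fun x => φ x = 0
  have h3 := Fintype.card_subtype_le fun x => φ x = 0
  rw [Nat.card_eq_fintype_card, Nat.card_eq_fintype_card]
  simp only [ne_eq] at h ⊢
  omega

theorem card_le_mul_card_prod {α β : Type} [Finite α] [Finite β] {Q : α → Prop} {P : α → β → Prop}
    {s t : ℕ} (hQ : Nat.card α ≤ s * Nat.card {a // Q a})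
    (hP : ∀ a, Q a → Nat.card β ≤ t * Nat.card {b // P a b}) :
    Nat.card (α × β) ≤ s * t * Nat.card {p : α × β // P p.1 p.2} := by
  classical
  have := Fintype.ofFinite α
  have := Fintype.ofFinite β
  have hsum : Nat.card {p : α × β // P p.1 p.2} = ∑ a, Nat.card {b // P a b} := by
    rw [← Nat.card_sigma]
    exact Nat.card_congr
      ⟨fun p => ⟨p.1.1, p.1.2, p.2⟩, fun p => ⟨(p.1, p.2.1), p.2.2⟩, fun _ => rfl, fun _ => rfl⟩
  have hle : Nat.card {a // Q a} * Nat.card β ≤ t * ∑ a, Nat.card {b // P a b} := by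
    rw [Nat.card_eq_fintype_card, Fintype.card_subtype, ← smul_eq_mul, ← Finset.sum_const,
      Finset.mul_sum]
    exact (Finset.sum_le_sum fun a ha => hP a (by simpa using ha)).trans
      (Finset.sum_le_sum_of_subset (Finset.subset_univ _))
  rw [Nat.card_prod, hsum]
  calc Nat.card α * Nat.card β ≤ s * Nat.card {a // Q a} * Nat.card β :=
        Nat.mul_le_mul_right _ hQ
    _ = s * (Nat.card {a // Q a} * Nat.card β) := mul_assoc _ _ _
    _ ≤ s * (t * ∑ a, Nat.card {b // P a b}) := Nat.mul_le_mul_left _ hle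
    _ = s * t * ∑ a, Nat.card {b // P a b} := (mul_assoc _ _ _).symm

/-- Starting from the witness, the coordinates are randomized one at a time, in the order `a`, `b`,
`c`, `d`; each keeps the value nonzero with probability at least 1/2. -/
theorem card_le_card_ne_zero_of_additive {V : Type} [AddCommGroup V] [Finite V]
    {D : V → V → V → V → ZMod 2}
    (ha : ∀ b c d x y, D (x + y) b c d = D x b c d + D y b c d)
    (hb : ∀ a c d x y, D a (x + y) c d = D a x c d + D a y c d)
    (hc : ∀ a b d x y, D a b (x + y) d = D a b x d + D a b y d)
    (hd : ∀ a b c x y, D a b c (x + y) = D a b c x + D a b c y)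
    {a b c d : V} (h : D a b c d ≠ 0) :
    Nat.card (V × V × V × V) ≤
      16 * Nat.card {p : V × V × V × V // D p.1 p.2.1 p.2.2.1 p.2.2.2 ≠ 0} := by
  have half : ∀ {f : V → ZMod 2} {x : V}, (∀ x y, f (x + y) = f x + f y) → f x ≠ 0 →
      Nat.card V ≤ 2 * Nat.card {x // f x ≠ 0} := fun {f x} hf hx =>
    two_mul_card_ne_zero (AddMonoidHom.mk' f hf) (g := x) hx
  have hcd : ∀ a b, D a b c d ≠ 0 →
      Nat.card (V × V) ≤ 2 * 2 * Nat.card {p : V × V // D a b p.1 p.2 ≠ 0} := fun a b h =>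
    card_le_mul_card_prod (Q := fun c => D a b c d ≠ 0) (P := fun c d => D a b c d ≠ 0)
      (half (hc a b d) h)
      fun c h => half (hd a b c) h
  have hbcd : ∀ a, D a b c d ≠ 0 → Nat.card (V × V × V) ≤
      2 * (2 * 2) * Nat.card {p : V × V × V // D a p.1 p.2.1 p.2.2 ≠ 0} := fun a h =>
    card_le_mul_card_prod (Q := fun b => D a b c d ≠ 0) (P := fun b (p : V × V) => D a b p.1 p.2 ≠ 0)
      (half (hb a c d) h)
      fun b h => hcd a b h
  exact card_le_mul_card_prod (s := 2) (t := 2 * (2 * 2)) (Q := fun a => D a b c d ≠ 0)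
    (P := fun a (p : V × V × V) => D a p.1 p.2.1 p.2.2 ≠ 0) (half (ha b c d) h) hbcd

/-! ### Random minors and the constant-cost protocol -/

/-- The vectors of a random `2 × 2` minor: two for the rows and two for the columns. -/
abbrev MinorCoins (n : ℕ) : Type :=
  (Fin n → ZMod 2) × (Fin n → ZMod 2) × (Fin n → ZMod 2) × (Fin n → ZMod 2)

/-- The `2 × 2` compression of a matrix along two row and two column vectors. -/
def compression (p : MinorCoins n) (M : Matrix (Fin n) (Fin n) (ZMod 2)) :
    (ZMod 2 × ZMod 2) × (ZMod 2 × ZMod 2) :=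
  ((p.1 ⬝ᵥ M *ᵥ p.2.2.1, p.1 ⬝ᵥ M *ᵥ p.2.2.2),
    (p.2.1 ⬝ᵥ M *ᵥ p.2.2.1, p.2.1 ⬝ᵥ M *ᵥ p.2.2.2))

/-- The determinant of a `2 × 2` matrix. -/
def minorDet (q : (ZMod 2 × ZMod 2) × (ZMod 2 × ZMod 2)) : ZMod 2 :=
  q.1.1 * q.2.2 - q.1.2 * q.2.1

/-- Additivity lets Bob form the compression of `A + B` from Alice's message about `A`. -/
theorem compression_add (p : MinorCoins n) (A B : Matrix (Fin n) (Fin n) (ZMod 2)) :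
    compression p (A + B) = compression p A + compression p B := by
  simp [compression, add_mulVec, dotProduct_add]

theorem minorDet_eq_zero_of_rank_le_one (p : MinorCoins n) {M : Matrix (Fin n) (Fin n) (ZMod 2)}
    (hM : M.rank ≤ 1) : minorDet (compression p M) = 0 := by
  obtain ⟨u, v, rfl⟩ := (rank_le_one_iff_exists_vecMulVec M).1 hM
  have h : ∀ a b, a ⬝ᵥ vecMulVec u v *ᵥ b = (a ⬝ᵥ u) * (v ⬝ᵥ b) := fun a b => by
    rw [vecMulVec_mulVec]
    simp [mul_comm]
  simp only [minorDet, compression, h]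
  ring

/-- Standard basis vectors give the ordinary `2 × 2` minors; if all of these vanish, any two nonzero
rows coincide. -/
theorem exists_minorDet_ne_zero {M : Matrix (Fin n) (Fin n) (ZMod 2)} (hM : ¬ M.rank ≤ 1) :
    ∃ p : MinorCoins n, minorDet (compression p M) ≠ 0 := by
  by_contra! h
  refine hM ((rank_le_one_iff_rows M).2 fun i k hi hk => ?_)
  have unit : ∀ a : ZMod 2, a ≠ 0 → a = 1 := by decide
  have e : ∀ j l, M i j * M k l = M i l * M k j := fun j l => by
    have := h (Pi.single i 1, Pi.single k 1, Pi.single j 1, Pi.single l 1)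
    simpa [minorDet, compression, sub_eq_zero] using this
  obtain ⟨j, hj⟩ := Function.ne_iff.1 hi
  obtain ⟨l, hl⟩ := Function.ne_iff.1 hk
  have hj := unit _ hj
  have hl := unit _ hl
  have hkj : M k j = 1 := unit _ fun h0 => by simpa [hj, hl, h0] using e j l
  funext m
  simpa [hj, hkj] using (e j m).symm

theorem card_le_card_minorDet_ne_zero {M : Matrix (Fin n) (Fin n) (ZMod 2)}
    (hM : ¬ M.rank ≤ 1) :
    Nat.card (MinorCoins n) ≤
      16 * Nat.card {p : MinorCoins n // minorDet (compression p M) ≠ 0} := by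
  obtain ⟨⟨a, b, c, d⟩, h⟩ := exists_minorDet_ne_zero hM
  refine card_le_card_ne_zero_of_additive (D := fun a b c d => minorDet (compression (a, b, c, d) M))
    ?_ ?_ ?_ ?_ h
  all_goals
    intros
    simp only [minorDet, compression, add_dotProduct, mulVec_add, dotProduct_add]
    ring

theorem card_forall_apply {R : Type} (p : R → Prop) (k : ℕ) :
    Nat.card {ω : Fin k → R // ∀ i, p (ω i)} = Nat.card {r // p r} ^ k := by
  rw [Nat.card_congr (Equiv.subtypePiEquivPi (β := fun _ : Fin k => R) (p := fun {_} r => p r)),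
    Nat.card_fun, Nat.card_fin]

/-- 18 is the least exponent `k` with `(15/16) ^ k ≤ 1/3`. -/
theorem three_mul_pow_le {s r : ℕ} (h : 16 * s ≤ 15 * r) : 3 * s ^ 18 ≤ r ^ 18 := by
  have hpow := Nat.pow_le_pow_left h 18
  rw [mul_pow, mul_pow] at hpow
  norm_num at hpow
  omega

/-- Alice sends 18 compressions of 4 bits each and Bob answers with one bit. The error is one-sided:
rank at most one is always accepted. -/
theorem hasRandCostLE_rankOne (n : ℕ) : HasRandCostLE (rankOne n) 73 := by
  classical
  refine hasRandCostLE_of_test (k := 72) (Ω := Fin 18 → MinorCoins n)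
    (T := Fin 18 → (ZMod 2 × ZMod 2) × (ZMod 2 × ZMod 2)) ?_
    (fun ω A i => compression (ω i) A)
    (fun ω q B => decide (∀ i, minorDet (q i + compression (ω i) B) = 0)) fun A B => ?_
  · simp only [Fintype.card_pi, Fintype.card_prod, ZMod.card]
    norm_num
  simp only [← compression_add, rankOne]
  by_cases h : (A + B).rank ≤ 1
  · simp [minorDet_eq_zero_of_rank_le_one _ h, h]
  · have h16 := card_le_card_minorDet_ne_zero h
    have hcompl : Nat.card {p : MinorCoins n // minorDet (compression p (A + B)) ≠ 0} =
        Nat.card (MinorCoins n) -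
          Nat.card {p : MinorCoins n // minorDet (compression p (A + B)) = 0} := by
      simp only [Nat.card_eq_fintype_card]
      exact Fintype.card_subtype_compl _
    have hle := Finite.card_subtype_le
      fun p : MinorCoins n => minorDet (compression p (A + B)) = 0
    rw [← Nat.card_eq_fintype_card, Nat.card_fun, Nat.card_fin]
    simp only [h, decide_false, ne_eq, decide_eq_false_iff_not, not_not]
    rw [card_forall_apply fun p : MinorCoins n => minorDet (compression p (A + B)) = 0]
    exact three_mul_pow_le (by omega)

/-! ### Asymptotics and padding to all input lengths -/

theorem le_two_mul_eqCost_rankOne (n : ℕ) : n ≤ 2 * eqCost (rankOne n) + 3 := by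
  have h := two_pow_le_of_hasEqCostLE (hasEqCostLE_eqCost (rankOne n))
  set c := eqCost (rankOne n)
  -- If `n ≥ 2 * c + 4`, then `2 ^ n ≥ 16 * 4 ^ c`, which exceeds `4 * 3 ^ c + 2`.
  by_contra! hn
  have h1 : (2 : ℝ) ^ (2 * c + 4) ≤ 2 ^ n := pow_le_pow_right₀ (by norm_num) hn
  have h2 : (3 : ℝ) ^ c ≤ 4 ^ c := pow_le_pow_left₀ (by norm_num) (by norm_num) c
  have h3 : (1 : ℝ) ≤ 4 ^ c := one_le_pow₀ (by norm_num)
  rw [pow_add, pow_mul] at h1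
  norm_num at h1
  linarith

/-- The constant 4 is the 3 of `le_two_mul_eqCost_rankOne` plus 1 for rounding `√n` down. -/
theorem isTheta_of_affine_bounds {a : ℕ → ℕ} {g : ℕ → ℝ} (hg : Tendsto g atTop atTop)
    (hupper : ∀ n, (a n : ℝ) ≤ g n + 1) (hlower : ∀ n, g n ≤ 2 * a n + 4) :
    (fun n => (a n : ℝ)) =Θ[atTop] g := by
  constructor
  · refine IsBigO.of_bound 2 ?_
    filter_upwards [hg.eventually_ge_atTop 1] with n hn
    rw [Real.norm_of_nonneg (Nat.cast_nonneg _), Real.norm_of_nonneg (by linarith)]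
    linarith [hupper n]
  · refine IsBigO.of_bound 4 ?_
    filter_upwards [hg.eventually_ge_atTop 8] with n hn
    rw [Real.norm_of_nonneg (Nat.cast_nonneg _), Real.norm_of_nonneg (by linarith)]
    linarith [hlower n]

/-- The bit string, padded with zeros, whose leading bits are the entries of a matrix. -/
def matrixToBits (m N : ℕ) (A : Matrix (Fin m) (Fin m) (ZMod 2)) (i : Fin N) : Bool :=
  if h : (i : ℕ) < m * m then
    decide (A (finProdFinEquiv.symm ⟨i, h⟩).1 (finProdFinEquiv.symm ⟨i, h⟩).2 ≠ 0)
  else false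

theorem bitsToMatrix_matrixToBits {m N : ℕ} (h : m * m ≤ N)
    (A : Matrix (Fin m) (Fin m) (ZMod 2)) :
    bitsToMatrix m (fun i => matrixToBits m N A (Fin.castLE h i)) = A := by
  have hite : ∀ a : ZMod 2, (if a = 0 then 0 else 1) = a := by decide
  ext i j
  have hlt : ((finProdFinEquiv (i, j) : Fin (m * m)) : ℕ) < m * m := Fin.is_lt _
  have hfin : (⟨((finProdFinEquiv (i, j) : Fin (m * m)) : ℕ), hlt⟩ : Fin (m * m)) =
      finProdFinEquiv (i, j) := rfl
  rw [bitsToMatrix, Matrix.of_apply, matrixToBits]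
  simp only [Fin.val_castLE, hlt, dif_pos, hfin, Equiv.symm_apply_apply]
  simp [hite]

/-- `RankOne` on strings of any length `n`: the first `m * m` bits with `m = ⌊√n⌋` are read as a
matrix. -/
noncomputable def rankOneProblem : CommProblem := fun n x y =>
  rankOne (Nat.sqrt n) (bitsToMatrix _ fun i => x (Fin.castLE (Nat.sqrt_le n) i))
    (bitsToMatrix _ fun i => y (Fin.castLE (Nat.sqrt_le n) i))

theorem rankOneProblem_mul_self (m : ℕ) (x y : Fin (m * m) → Bool) :
    rankOneProblem (m * m) x y = rankOne m (bitsToMatrix m x) (bitsToMatrix m y) := by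
  -- `Nat.sqrt (m * m)` is only propositionally `m` and occurs in the matrix types, so it is
  -- generalized to `k` first.
  have key : ∀ k (h : k * k ≤ m * m), k = m →
      rankOne k (bitsToMatrix k fun i => x (Fin.castLE h i))
        (bitsToMatrix k fun i => y (Fin.castLE h i)) =
      rankOne m (bitsToMatrix m x) (bitsToMatrix m y) := by
    rintro k h rfl
    rfl
  exact key _ _ (Nat.sqrt_eq m)

theorem randCost_rankOne_le (n : ℕ) : randCost (rankOne n) ≤ 73 :=
  randCost_le (hasRandCostLE_rankOne n)

theorem randCost_rankOneProblem_le (n : ℕ) : randCost (rankOneProblem n) ≤ 73 :=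
  randCost_le ((hasRandCostLE_rankOne (Nat.sqrt n)).comap _ _)

/-- Reading a prefix and padding with zeros are local translations, so the two problems reduce to
each other at no cost. -/
theorem eqCost_rankOneProblem (n : ℕ) :
    eqCost (rankOneProblem n) = eqCost (rankOne (Nat.sqrt n)) := by
  refine le_antisymm (eqCost_le ((hasEqCostLE_eqCost _).comap _ _)) (eqCost_le ?_)
  have h := (hasEqCostLE_eqCost (rankOneProblem n)).comap
    (matrixToBits (Nat.sqrt n) n) (matrixToBits (Nat.sqrt n) n)
  simpa only [rankOneProblem, bitsToMatrix_matrixToBits] using h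

theorem isTheta_eqCost_rankOne :
    (fun n : ℕ => (eqCost (rankOne n) : ℝ)) =Θ[atTop] fun n : ℕ => (n : ℝ) := by
  refine isTheta_of_affine_bounds tendsto_natCast_atTop_atTop (fun n => ?_) fun n => ?_
  · exact_mod_cast eqCost_le (hasEqCostLE_rankOne n)
  · exact_mod_cast (le_two_mul_eqCost_rankOne n).trans (by omega)

theorem isTheta_eqCost_rankOneProblem :
    (fun n : ℕ => (eqCost (rankOneProblem n) : ℝ)) =Θ[atTop] fun n : ℕ => √(n : ℝ) := by
  refine isTheta_of_affine_bounds
    (Real.tendsto_sqrt_atTop.comp tendsto_natCast_atTop_atTop) (fun n => ?_) fun n => ?_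
  · have h1 : (eqCost (rankOne (Nat.sqrt n)) : ℝ) ≤ Nat.sqrt n + 1 := by
      exact_mod_cast eqCost_le (hasEqCostLE_rankOne (Nat.sqrt n))
    have h2 : (Nat.sqrt n : ℝ) ≤ √(n : ℝ) := Real.nat_sqrt_le_real_sqrt
    rw [eqCost_rankOneProblem]
    linarith
  · have h1 : (Nat.sqrt n : ℝ) ≤ 2 * eqCost (rankOne (Nat.sqrt n)) + 3 := by
      exact_mod_cast le_two_mul_eqCost_rankOne (Nat.sqrt n)
    have h2 : √(n : ℝ) ≤ Nat.sqrt n + 1 := Real.real_sqrt_le_nat_sqrt_succ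
    rw [eqCost_rankOneProblem]
    linarith

theorem isLittleO_log_pow_sqrt (k : ℕ) :
    (fun n : ℕ => Real.log (n : ℝ) ^ k) =o[atTop] fun n : ℕ => √(n : ℝ) := by
  have h := (isLittleO_log_rpow_rpow_atTop (k : ℝ) (by norm_num : (0 : ℝ) < 1 / 2)).comp_tendsto
    (tendsto_natCast_atTop_atTop (R := ℝ))
  simpa only [Function.comp_def, Real.rpow_natCast, ← Real.sqrt_eq_rpow] using h

theorem rankOneProblem_notMem_PEq : rankOneProblem ∉ PEq := by
  rintro ⟨k, hk⟩
  have h := (isTheta_eqCost_rankOneProblem.isBigO_symm.trans hk).trans_isLittleO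
    (isLittleO_log_pow_sqrt k)
  refine isLittleO_irrefl (Eventually.frequently ?_) h
  filter_upwards [eventually_gt_atTop 0] with n hn
  positivity

end EqOracle

theorem theorem1 :
    -- `RankOne_n`, on inputs of `n * n` bits: constant randomized cost, Equality-oracle cost `Θ(n)`
    ((∃ C : ℕ, ∀ n : ℕ, EqOracle.randCost (EqOracle.rankOne n) ≤ C) ∧
      (fun n : ℕ => (EqOracle.eqCost (EqOracle.rankOne n) : ℝ)) =Θ[atTop] fun n : ℕ => (n : ℝ)) ∧
    -- a problem on `n`-bit inputs for every `n`, which is `RankOne_m` for `n = m * m`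
    (∃ F : EqOracle.CommProblem,
      (∀ (m : ℕ) (x y : Fin (m * m) → Bool),
        F (m * m) x y =
          EqOracle.rankOne m (EqOracle.bitsToMatrix m x) (EqOracle.bitsToMatrix m y)) ∧
      (∃ C : ℕ, ∀ n : ℕ, EqOracle.randCost (F n) ≤ C) ∧
      (fun n : ℕ => (EqOracle.eqCost (F n) : ℝ)) =Θ[atTop] fun n : ℕ => √(n : ℝ)) ∧
    -- `BPP_0` is not contained in `P^Eq`
    ¬ EqOracle.BPP0 ⊆ EqOracle.PEq :=
  ⟨⟨⟨73, EqOracle.randCost_rankOne_le⟩, EqOracle.isTheta_eqCost_rankOne⟩,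
    ⟨EqOracle.rankOneProblem, EqOracle.rankOneProblem_mul_self,
      ⟨73, EqOracle.randCost_rankOneProblem_le⟩, EqOracle.isTheta_eqCost_rankOneProblem⟩,
    fun h => EqOracle.rankOneProblem_notMem_PEq (h ⟨73, EqOracle.randCost_rankOneProblem_le⟩)⟩
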